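/- Let $k\ge 0$ be an integer, let $\Omega\subset\mathbb{R}^{2k+1}$ be a compact domain with piecewise smooth boundary, and let $\alpha$ be a smooth closed Dirichlet $(k+1)$-form on $\Omega$, that is, $d\alpha=0$ and $\alpha(V_1,\dots,V_{k+1})=0$ whenever $V_1,\dots,V_{k+1}$ are all tangent to $\partial\Omega$. Let $C_2[\Omega]$ be the Fulton--MacPherson compactification of the space $C_2(\Omega)$ of ordered pairs of distinct points of $\Omega$, i.e. the closure of the image of $C_2(\Omega)$ under $$(x,y)\mapsto\Bigl(x,\;y,\;\tfrac{x-y}{\|x-y\|},\;\tfrac{y-x}{\|y-x\|}\Bigr)\in\Omega\times\Omega\times S^{2k}\times S^{2k},$$ oriented by $d\mathrm{Vol}_x\wedge d\mathrm{Vol}_y$. Let $\alpha_x,\alpha_y$ be the pullbacks of $\alpha$ to $C_2[\Omega]$ under $(x,y)\mapsto x$ and $(x,y)\mapsto y$, and let $g\colon C_2[\Omega]\to S^{2k}$ be the Gauss map, the extension of $(x,y)\mapsto (y-x)/\|y-x\|$. Let $d\mathrm{Vol}_{S^{2k}}$, given by $u\mapsto\det(u,\cdot,\dots,\cdot)$,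 be the standard volume form of $S^{2k}$, and $d\mathrm{Vol}=\mathrm{Vol}(S^{2k})^{-1}\,d\mathrm{Vol}_{S^{2k}}$ the unit volume form. Define the Biot--Savart operator by integration over the fiber $C_{2,1}[\Omega]$ of $C_2[\Omega]\to\Omega$, $(x,y)\mapsto x$: $$BS(\alpha)=\frac{1}{\mathrm{Vol}(S^{2k})}\int_{C_{2,1}[\Omega]}\alpha_y\wedge g^*d\mathrm{Vol}_{S^{2k}},$$ a $k$-form on $\Omega$ (with the convention that fiber integration takes $\beta_x\wedge\theta$ to $\beta\wedge\int_{C_{2,1}[\Omega]}\theta$). Then all the integrals involved converge absolutely, and the Arnol'd helicity equals the configuration-space helicity: $$\int_\Omega\alpha\wedge BS(\alpha)=\int_{C_2[\Omega]}\alpha_x\wedge\alpha_y\wedge g^*d\mathrm{Vol}.$$ -/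

import Mathlib

open MeasureTheory Set
open scoped ContDiff

namespace Helicity

noncomputable section

/-! ### Differential forms on normed spaces -/

section Forms

variable {V W : Type*} [NormedAddCommGroup V] [NormedSpace ℝ V]
  [NormedAddCommGroup W] [NormedSpace ℝ W]

/-- A (not necessarily smooth) differential `p`-form on the vector space `V`. A form on a subset
of `V` is represented by a form on `V` of which only the values on that subset matter. -/
abbrev DForm (V : Type*) [NormedAddCommGroup V] [NormedSpace ℝ V] (p : ℕ) : Type _ :=
  V → V [⋀^Fin p]→L[ℝ] ℝ

/-- An alternating map that is continuous, as a continuous alternating map. -/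
def ofContinuous {p : ℕ} (f : V [⋀^Fin p]→ₗ[ℝ] ℝ) (hf : Continuous f) : V [⋀^Fin p]→L[ℝ] ℝ :=
  { toContinuousMultilinearMap := ⟨f.toMultilinearMap, hf⟩
    map_eq_zero_of_eq' := f.map_eq_zero_of_eq' }

@[simp] theorem ofContinuous_apply {p : ℕ} (f : V [⋀^Fin p]→ₗ[ℝ] ℝ) (hf : Continuous f)
    (v : Fin p → V) : ofContinuous f hf v = f v := rfl

/-- The wedge product of alternating maps,
`(a ∧ b)(v) = ∑ over (p,q)-shuffles σ of sign σ * a (v ∘ σ ∘ left) * b (v ∘ σ ∘ right)`,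
without the continuity. -/
def wedgeAlg {p q r : ℕ} (h : p + q = r) (a : V [⋀^Fin p]→ₗ[ℝ] ℝ) (b : V [⋀^Fin q]→ₗ[ℝ] ℝ) :
    V [⋀^Fin r]→ₗ[ℝ] ℝ :=
  ((LinearMap.mul' ℝ ℝ).compAlternatingMap (a.domCoprod b)).domDomCongr
    (finSumFinEquiv.trans (finCongr h))

theorem continuous_wedgeAlg {p q r : ℕ} (h : p + q = r) (a : V [⋀^Fin p]→L[ℝ] ℝ)
    (b : V [⋀^Fin q]→L[ℝ] ℝ) :
    Continuous (wedgeAlg h a.toAlternatingMap b.toAlternatingMap) := by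
  have key : ∀ σ : Equiv.Perm.ModSumCongr (Fin p) (Fin q), Continuous fun v : Fin p ⊕ Fin q → V =>
      LinearMap.mul' ℝ ℝ
        (AlternatingMap.domCoprod.summand a.toAlternatingMap b.toAlternatingMap σ v) := by
    intro σ
    induction σ using Quotient.inductionOn' with
    | h σ =>
      have : (fun v : Fin p ⊕ Fin q → V => LinearMap.mul' ℝ ℝ
          (AlternatingMap.domCoprod.summand a.toAlternatingMap b.toAlternatingMap
            (Quotient.mk'' σ) v)) =
          fun v => ((Equiv.Perm.sign σ : ℤ) : ℝ) *
            (a (fun i => v (σ (Sum.inl i))) * b (fun i => v (σ (Sum.inr i)))) := by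
        funext v
        rw [AlternatingMap.domCoprod.summand_mk'']
        rcases Int.units_eq_one_or (Equiv.Perm.sign σ) with hs | hs <;> rw [hs]
        · rw [one_smul]
          simp [MultilinearMap.domDomCongr_apply]
        · rw [Units.neg_smul, one_smul]
          simp [MultilinearMap.domDomCongr_apply]
      rw [this]
      refine continuous_const.mul (Continuous.mul ?_ ?_)
      · exact a.coe_continuous.comp (by fun_prop)
      · exact b.coe_continuous.comp (by fun_prop)
  have : ⇑(wedgeAlg h a.toAlternatingMap b.toAlternatingMap) = fun v : Fin r → V =>
      ∑ σ : Equiv.Perm.ModSumCongr (Fin p) (Fin q), LinearMap.mul' ℝ ℝ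
        (AlternatingMap.domCoprod.summand a.toAlternatingMap b.toAlternatingMap σ
          (v ∘ finSumFinEquiv.trans (finCongr h))) := by
    funext v
    simp only [wedgeAlg, AlternatingMap.domDomCongr_apply, LinearMap.compAlternatingMap_apply,
      AlternatingMap.domCoprod_apply, sum_apply, map_sum]
  rw [this]
  exact continuous_finsetSum _ fun σ _ => (key σ).comp (by fun_prop)

/-- The wedge product of continuous alternating maps. The equation `h` only fixes how the degree
of the product is written. -/
def wedgeAt {p q r : ℕ} (h : p + q = r) (a : V [⋀^Fin p]→L[ℝ] ℝ) (b : V [⋀^Fin q]→L[ℝ] ℝ) :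
    V [⋀^Fin r]→L[ℝ] ℝ :=
  ofContinuous (wedgeAlg h a.toAlternatingMap b.toAlternatingMap) (continuous_wedgeAlg h a b)

/-- The wedge product of differential forms. -/
def wedge {p q r : ℕ} (h : p + q = r) (α : DForm V p) (β : DForm V q) : DForm V r :=
  fun x => wedgeAt h (α x) (β x)

/-- The pullback of a differential form under a (smooth) map. -/
def pullback {p : ℕ} (f : V → W) (θ : DForm W p) : DForm V p :=
  fun x => (θ (f x)).compContinuousLinearMap (fderiv ℝ f x)

/-- Partial evaluation `v ↦ θ (ℓ v₁, …, ℓ v_d, f₁, …, f_m)`, without the continuity. -/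
def fillLastAlg {d m p : ℕ} (h : d + m = p) (θ : W [⋀^Fin p]→ₗ[ℝ] ℝ) (ℓ : V →ₗ[ℝ] W)
    (f : Fin m → W) : V [⋀^Fin d]→ₗ[ℝ] ℝ where
  toFun v := θ (Fin.append (ℓ ∘ v) f ∘ Fin.cast h.symm)
  map_update_add' := by
    subst h
    intro _ v i x y
    have e : ∀ z, (Fin.append (ℓ ∘ Function.update v i z) f : Fin (d + m) → W) =
        Function.update (Fin.append (ℓ ∘ v) f) (Fin.castAdd m i) (ℓ z) := by
      intro z
      funext j
      refine Fin.addCases (fun j => ?_) (fun j => ?_) j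
      · by_cases hj : j = i
        · subst hj; simp
        · simp [Function.update_of_ne, hj]
      · have : Fin.natAdd d j ≠ Fin.castAdd m i := by
          intro hh
          have := congrArg Fin.val hh
          simp at this
          omega
        simp [Function.update_of_ne this]
    simp only [Fin.cast_refl, Function.comp_id, e, map_add]
    exact θ.map_update_add _ _ _ _
  map_update_smul' := by
    subst h
    intro _ v i c x
    have e : ∀ z, (Fin.append (ℓ ∘ Function.update v i z) f : Fin (d + m) → W) =
        Function.update (Fin.append (ℓ ∘ v) f) (Fin.castAdd m i) (ℓ z) := by
      intro z
      funext j
      refine Fin.addCases (fun j => ?_) (fun j => ?_) j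
      · by_cases hj : j = i
        · subst hj; simp
        · simp [Function.update_of_ne, hj]
      · have : Fin.natAdd d j ≠ Fin.castAdd m i := by
          intro hh
          have := congrArg Fin.val hh
          simp at this
          omega
        simp [Function.update_of_ne this]
    simp only [Fin.cast_refl, Function.comp_id, e, map_smul]
    exact θ.map_update_smul _ _ _ _
  map_eq_zero_of_eq' := by
    subst h
    intro v i j hv hij
    refine θ.map_eq_zero_of_eq _ (i := Fin.castAdd m i) (j := Fin.castAdd m j) ?_ ?_
    · simp [hv]
    · simpa using hij

theorem continuous_fillLastAlg {d m p : ℕ} (h : d + m = p) (θ : W [⋀^Fin p]→L[ℝ] ℝ)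
    (ℓ : V →L[ℝ] W) (f : Fin m → W) :
    Continuous (fillLastAlg h θ.toAlternatingMap (ℓ : V →ₗ[ℝ] W) f) := by
  subst h
  refine θ.coe_continuous.comp ?_
  refine continuous_pi fun j => ?_
  refine Fin.addCases (fun j => ?_) (fun j => ?_) j
  · have : (fun v : Fin d → V => (Fin.append (⇑(ℓ : V →ₗ[ℝ] W) ∘ v) f ∘ Fin.cast rfl)
        (Fin.castAdd m j)) = fun v => ℓ (v j) := by
      funext v
      simp
    exact this ▸ ℓ.continuous.comp (continuous_apply j)
  · have : (fun v : Fin d → V => (Fin.append (⇑(ℓ : V →ₗ[ℝ] W) ∘ v) f ∘ Fin.cast rfl)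
        (Fin.natAdd d j)) = fun _ => f j := by
      funext v
      simp
    exact this ▸ continuous_const

/-- Partial evaluation `v ↦ θ (ℓ v₁, …, ℓ v_d, f₁, …, f_m)` of an alternating map on `W` at
vectors `f₁, …, f_m`, with the other arguments lifted from `V` by `ℓ`. -/
def fillLast {d m p : ℕ} (h : d + m = p) (θ : W [⋀^Fin p]→L[ℝ] ℝ) (ℓ : V →L[ℝ] W)
    (f : Fin m → W) : V [⋀^Fin d]→L[ℝ] ℝ :=
  ofContinuous (fillLastAlg h θ.toAlternatingMap (ℓ : V →ₗ[ℝ] W) f)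
    (continuous_fillLastAlg h θ ℓ f)

end Forms

/-! ### Domains and Dirichlet forms in Euclidean space -/

/-- Euclidean space of dimension `2k+1`. -/
abbrev E (k : ℕ) : Type := EuclideanSpace ℝ (Fin (2 * k + 1))

/-- The standard, positively oriented orthonormal frame of `ℝ^(2k+1)`. -/
def stdFrame (k : ℕ) : Fin (2 * k + 1) → E k := fun i => EuclideanSpace.basisFun _ ℝ i

/-- A compact domain in `ℝ^(2k+1)` with piecewise smooth boundary: a compact set that is the closure
of its interior and whose topological boundary lies, near each of its points, in a finite union of
smooth hypersurfaces. (It need not be connected.) -/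
structure IsCompactDomain {k : ℕ} (Ω : Set (E k)) : Prop where
  isCompact : IsCompact Ω
  closure_interior : closure (interior Ω) = Ω
  piecewise_smooth : ∀ p ∈ frontier Ω, ∃ U : Set (E k), IsOpen U ∧ p ∈ U ∧
    ∃ (m : ℕ) (ρ : Fin m → E k → ℝ),
      (∀ i, ContDiffOn ℝ ∞ (ρ i) U ∧ ∀ x ∈ U, fderiv ℝ (ρ i) x ≠ 0) ∧
      frontier Ω ∩ U ⊆ ⋃ i, {x | ρ i x = 0}

/-- `ρ` is a defining function of `Ω` near the boundary point `p`; so `∂Ω` is a smooth hypersurface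
near `p`, with tangent space `ker dρ_p` at `p`. -/
def IsDefiningFunctionAt {k : ℕ} (Ω : Set (E k)) (p : E k) (ρ : E k → ℝ) : Prop :=
  ∃ U : Set (E k), IsOpen U ∧ p ∈ U ∧ ContDiffOn ℝ ∞ ρ U ∧ fderiv ℝ ρ p ≠ 0 ∧
    Ω ∩ U = {x | ρ x ≤ 0} ∩ U

/-- The form `α` vanishes on all tuples of vectors tangent to `∂Ω` (at the points at which `∂Ω` is
smooth, hence, by continuity, on each smooth piece of `∂Ω`). -/
def IsDirichlet {k p : ℕ} (Ω : Set (E k)) (α : DForm (E k) p) : Prop :=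
  ∀ x ∈ frontier Ω, ∀ ρ : E k → ℝ, IsDefiningFunctionAt Ω x ρ →
    ∀ v : Fin p → E k, (∀ i, fderiv ℝ ρ x (v i) = 0) → α x v = 0

/-- `α` is a closed, smooth (up to the boundary) Dirichlet `p`-form on `Ω`. The equation `dα = 0` is
required in the interior of `Ω`, which is dense in `Ω`. -/
structure IsClosedDirichletForm {k p : ℕ} (Ω : Set (E k)) (α : DForm (E k) p) : Prop where
  smooth : ContDiffOn ℝ ∞ α Ω
  closed : ∀ x ∈ interior Ω, extDeriv α x = 0
  dirichlet : IsDirichlet Ω α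

/-! ### The sphere -/

/-- The unit sphere `S^(2k)` in `ℝ^(2k+1)`. -/
abbrev S (k : ℕ) : Type := Metric.sphere (0 : E k) 1

/-- The surface measure on `S^(2k)`. -/
def sphereMeasure (k : ℕ) : Measure (S k) := (volume : Measure (E k)).toSphere

/-- The total area `Vol(S^(2k))`. -/
def sphereVol (k : ℕ) : ℝ := (sphereMeasure k).real univ

/-- The determinant with respect to the standard basis, as a continuous alternating map. -/
def detForm (k : ℕ) : E k [⋀^Fin (2 * k + 1)]→L[ℝ] ℝ :=
  ofContinuous (EuclideanSpace.basisFun (Fin (2 * k + 1)) ℝ).toBasis.det (by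
    have : ⇑(EuclideanSpace.basisFun (Fin (2 * k + 1)) ℝ).toBasis.det =
        fun v : Fin (2 * k + 1) → E k => Matrix.det (Matrix.of fun i j => v j i) := by
      funext v
      rw [Module.Basis.det_apply]
      rfl
    rw [this]
    refine Continuous.matrix_det ?_
    refine continuous_matrix fun i j => ?_
    simp only [Matrix.of_apply]
    fun_prop)

/-- The form `u ↦ det(u, ·, …, ·)` on `ℝ^(2k+1)`, whose restriction to `S^(2k)` is the
standard volume form of the sphere. -/
def sphereForm (k : ℕ) : DForm (E k) (2 * k) := fun u => (detForm k).curryLeft u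

/-- The unit volume form of `S^(2k)`: the multiple of the standard one of total integral `1`. -/
def unitSphereForm (k : ℕ) : DForm (E k) (2 * k) := fun u => (sphereVol k)⁻¹ • sphereForm k u

/-! ### The compactified configuration space of two points -/

/-- The configuration space `C_2(Ω)` of ordered pairs of distinct points of `Ω`. -/
def config {k : ℕ} (Ω : Set (E k)) : Set (E k × E k) :=
  {p | p.1 ∈ Ω ∧ p.2 ∈ Ω ∧ p.1 ≠ p.2}

/-- The vector space `ℝ^n × ℝ^n × ℝ^n × ℝ^n`, `n = 2k+1`, with coordinates `(x, y, π₁₂, π₂₁)`; it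
contains the closed subset `A_2 = ℝ^n × ℝ^n × S^(n-1) × S^(n-1)`, in which the
Fulton-MacPherson compactification is defined. -/
abbrev Amb (k : ℕ) : Type := E k × E k × E k × E k

/-- The unit vector in the direction of `a - b`. -/
def dir {k : ℕ} (a b : E k) : E k := ‖a - b‖⁻¹ • (a - b)

/-- The map `(x, y) ↦ (x, y, π₁₂, π₂₁)`, which embeds `C_2(Ω)` in `A_2`. -/
def configEmb {k : ℕ} (p : E k × E k) : Amb k := (p.1, p.2, dir p.1 p.2, dir p.2 p.1)

/-- The Fulton-MacPherson compactification `C_2[Ω]`: the closure of the image of `C_2(Ω)`. -/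
def compactConfig {k : ℕ} (Ω : Set (E k)) : Set (Amb k) := closure (configEmb '' config Ω)

/-- The projection `(x, y) ↦ x` of `C_2[Ω]`. -/
def projX {k : ℕ} (q : Amb k) : E k := q.1

/-- The projection `(x, y) ↦ y` of `C_2[Ω]`. -/
def projY {k : ℕ} (q : Amb k) : E k := q.2.1

/-- The Gauss map on `C_2[Ω]`: the coordinate `π₂₁`, which on `C_2(Ω)`
is `(x, y) ↦ (y - x) / ‖y - x‖`. -/
def gauss {k : ℕ} (q : Amb k) : E k := q.2.2.2

/-! Boundary spherical coordinates `(x, r, u)`, with `r = ‖y - x‖ ≥ 0` and `u` the unit vector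
pointing from `x` to `y`. They are global coordinates on the compactification: they identify
`C_2[ℝ^n]` with `ℝ^n × [0, ∞) × S^(n-1)`, the face where the two points collide being `r = 0`. -/

/-- The point of `C_2[ℝ^n]` with coordinates `(x, r, u)`, as a (polynomial) map defined for all
`(x, r, u) ∈ ℝ^n × ℝ × ℝ^n`. -/
def blowup {k : ℕ} (q : E k × ℝ × E k) : Amb k := (q.1, q.1 + q.2.1 • q.2.2, -q.2.2, q.2.2)

/-- Every point of `C_2[Ω]` has unique coordinates `(x, r, u)` with `r ≥ 0` and `‖u‖ = 1`. -/
theorem existsUnique_blowup {k : ℕ} (Ω : Set (E k)) {q : Amb k} (hq : q ∈ compactConfig Ω) :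
    ∃! c : E k × ℝ × S k, 0 ≤ c.2.1 ∧ blowup (c.1, c.2.1, (c.2.2 : E k)) = q := by
  have hcl : compactConfig Ω ⊆ {q : Amb k | q.2.1 - q.1 = ‖q.2.1 - q.1‖ • q.2.2.2 ∧
      q.2.2.1 = -q.2.2.2 ∧ ‖q.2.2.2‖ = 1} := by
    refine closure_minimal ?_ ?_
    · rintro _ ⟨⟨x, y⟩, ⟨-, -, hne⟩, rfl⟩
      have hn : ‖y - x‖ ≠ 0 := norm_ne_zero_iff.mpr (sub_ne_zero.mpr (Ne.symm hne))
      refine ⟨?_, ?_, ?_⟩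
      · simp [configEmb, dir, smul_smul, hn]
      · simp only [configEmb, dir]
        rw [norm_sub_rev x y, ← smul_neg, neg_sub]
      · simp [configEmb, dir, norm_smul, hn]
    · refine IsClosed.and ?_ (IsClosed.and ?_ ?_)
      · exact isClosed_eq (by fun_prop) (by fun_prop)
      · exact isClosed_eq (by fun_prop) (by fun_prop)
      · exact isClosed_eq (by fun_prop) (by fun_prop)
  obtain ⟨h1, h2, h3⟩ := hcl hq
  obtain ⟨x, y, w, u⟩ := q
  simp only at h1 h2 h3
  refine ⟨(x, ‖y - x‖, ⟨u, by simp [h3]⟩), ⟨norm_nonneg _, ?_⟩, ?_⟩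
  · simp [blowup, h2, ← h1]
  · rintro ⟨x', r, ⟨u', hu'⟩⟩ ⟨hr, he⟩
    simp only [blowup, Prod.mk.injEq] at he
    obtain ⟨rfl, h, -, rfl⟩ := he
    have : ‖y - x'‖ = r := by
      rw [← h]
      simp [norm_smul, h3, abs_of_nonneg hr]
    simp [this]

/-- `C_2[Ω]` in the coordinates `(x, r, u)`. -/
def configParam {k : ℕ} (Ω : Set (E k)) : Set (E k × ℝ × S k) :=
  {c | 0 ≤ c.2.1 ∧ blowup (c.1, c.2.1, (c.2.2 : E k)) ∈ compactConfig Ω}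

/-- The fiber `C_{2,1}[Ω]` of `(x, y) ↦ x` over the point `x`, in the coordinates `(r, u)`. -/
def fiberParam {k : ℕ} (Ω : Set (E k)) (x : E k) : Set (ℝ × S k) :=
  {c | (x, c) ∈ configParam Ω}

/-- The product measure on `[0, ∞) × S^(2k)`, carried by `ℝ × S^(2k)`. -/
def fiberMeasure (k : ℕ) : Measure (ℝ × S k) := (volume : Measure ℝ).prod (sphereMeasure k)

/-- The product measure on `ℝ^(2k+1) × [0, ∞) × S^(2k)`. -/
def configMeasure (k : ℕ) : Measure (E k × ℝ × S k) :=
  (volume : Measure (E k)).prod (fiberMeasure k)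

/-- The vectors `(e_i, 0, 0)`, tangent to the first factor of `ℝ^n × ℝ × S^(n-1)`. -/
def baseLift (k : ℕ) : E k →L[ℝ] E k × ℝ × E k := ContinuousLinearMap.inl ℝ (E k) (ℝ × E k)

/-- An orthonormal frame of `T_(r,u) (ℝ × S^(n-1)) = ℝ ∂_r ⊕ uᗮ`: the image of the standard
frame of `ℝ^n = ℝ u ⊕ uᗮ` under the isometry that takes `u` to `∂_r` and is the identity
on `uᗮ`. It is oriented so that, for `r > 0`, the coordinates `(r, u) ↦ r u` preserve
the orientation. -/
def fiberFrame {k : ℕ} (u : S k) : Fin (2 * k + 1) → E k × ℝ × E k := fun j =>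
  (0, inner ℝ (u : E k) (stdFrame k j),
    stdFrame k j - inner ℝ (u : E k) (stdFrame k j) • (u : E k))

/-- The frame of `ℝ^n × ℝ × S^(n-1)` consisting of the standard frame of the first factor, followed
by the frame of the other two. It is oriented so that the orientation of `C_2[Ω]` is that
of `dVol_x ∧ dVol_y`. -/
def configFrame {k : ℕ} (u : S k) : Fin (4 * k + 2) → E k × ℝ × E k :=
  Fin.append (fun i => baseLift k (stdFrame k i)) (fiberFrame u) ∘
    Fin.cast (by omega : 4 * k + 2 = (2 * k + 1) + (2 * k + 1))

/-! ### Integration -/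

/-- The density, with respect to the volume, of a form of top degree on `ℝ^(2k+1)`. -/
def domainDensity {k : ℕ} (η : DForm (E k) (2 * k + 1)) (x : E k) : ℝ := η x (stdFrame k)

/-- The integral over `Ω` of a form of top degree. -/
def domainIntegral {k : ℕ} (Ω : Set (E k)) (η : DForm (E k) (2 * k + 1)) : ℝ :=
  ∫ x in Ω, domainDensity η x

/-- The density, in the coordinates `(x, r, u)` and with respect to the product
measure, of a form of top degree on `C_2[Ω]`. -/
def configDensity {k : ℕ} (θ : DForm (Amb k) (4 * k + 2)) (c : E k × ℝ × S k) : ℝ :=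
  pullback blowup θ (c.1, c.2.1, (c.2.2 : E k)) (configFrame c.2.2)

/-- The integral over `C_2[Ω]` of a form of top degree. -/
def configIntegral {k : ℕ} (Ω : Set (E k)) (θ : DForm (Amb k) (4 * k + 2)) : ℝ :=
  ∫ c in configParam Ω, configDensity θ c ∂(configMeasure k)

/-- The integrand of the integration of `θ` over the fiber of `(x, y) ↦ x`: the `d`-form
`θ (lifts of v₁, …, v_d; frame of the fiber)` in `v`. (It does not depend on the choice of
the lifts, because two lifts differ by a vector tangent to the fiber.) -/
def fiberDensity {k d p : ℕ} (h : d + (2 * k + 1) = p) (θ : DForm (Amb k) p) (x : E k)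
    (c : ℝ × S k) : E k [⋀^Fin d]→L[ℝ] ℝ :=
  fillLast h (pullback blowup θ (x, c.1, (c.2 : E k))) (baseLift k) (fiberFrame c.2)

/-- Integration over the fibers of `C_2[Ω] → Ω`, `(x, y) ↦ x`. It takes forms of degree
`d + (2k+1)` on `C_2[Ω]` to forms of degree `d` on `Ω`. In the integrand the base vectors stand
first, so that fiber integration takes `β_x ∧ θ` to `β ∧ (fiber integral of θ)`. -/
def fiberIntegral {k d p : ℕ} (h : d + (2 * k + 1) = p) (Ω : Set (E k)) (θ : DForm (Amb k) p) :
    DForm (E k) d :=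
  fun x => ∫ c in fiberParam Ω x, fiberDensity h θ x c ∂(fiberMeasure k)

/-! ### The Biot-Savart operator and helicity -/

/-- The form `α_y ∧ g^*dVol` on `C_2[Ω]`, with the standard volume form of the sphere. -/
def biotSavartForm {k : ℕ} (α : DForm (E k) (k + 1)) : DForm (Amb k) (3 * k + 1) :=
  wedge (by omega) (pullback projY α) (pullback gauss (sphereForm k))

/-- The Biot-Savart operator
`BS(α) = Vol(S^(2k))⁻¹ ∫_{C_{2,1}[Ω]} α_y ∧ g^*dVol`. -/
def BS {k : ℕ} (Ω : Set (E k)) (α : DForm (E k) (k + 1)) : DForm (E k) k :=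
  fun x => (sphereVol k)⁻¹ • fiberIntegral (by omega) Ω (biotSavartForm α) x

/-- The form `α ∧ BS(α)` on `Ω`. -/
def arnoldForm {k : ℕ} (Ω : Set (E k)) (α : DForm (E k) (k + 1)) : DForm (E k) (2 * k + 1) :=
  wedge (by omega) α (BS Ω α)

/-- The form `α_x ∧ α_y ∧ g^*dVol` on `C_2[Ω]`, with the unit volume form of the sphere. -/
def helicityForm {k : ℕ} (α : DForm (E k) (k + 1)) : DForm (Amb k) (4 * k + 2) :=
  wedge (p := 2 * k + 2) (by omega)
    (wedge (by omega) (pullback projX α) (pullback projY α)) (pullback gauss (unitSphereForm k))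

end

end Helicity

/-!
Why the two helicities agree. In the coordinates `(x, r, u)`, `y = x + r u`, the forms `α_x`, `α_y`
and `g^*dVol` become the pullbacks of `α` at `x`, of `α` at `y` and of the volume form at `u` under
linear maps that depend polynomially on `(x, r, u)`. So both integrands are continuous up to the
face `r = 0`, and the domains of integration are compact (`isCompact_configParam`,
`isCompact_fiberParam`): nothing is singular in these coordinates, and all integrals converge
absolutely.

The helicity density is evaluated on `n = 2k+1` lifts of base vectors followed by the `n` vectors of
the fiber frame. By associativity (`wedgeAt_assoc`) the form is `α_x ∧ (α_y ∧ g^*dVol)`, and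
`α_x` kills the vectors tangent to the fiber. Hence only those shuffles contribute which hand all
of the fiber frame to the second factor (`wedgeSum_fill`, `wedgeAt_append`), and the density is
that of the wedge product of `α` with the Biot-Savart integrand (`configDensity_helicityForm`).
Integrating over the fiber, which commutes with the linear operation `α ∧ ·`, gives the density of
`α ∧ BS(α)` (`domainDensity_arnoldForm`), and Fubini's theorem finishes the proof.
-/

namespace Helicity

/-! ### The algebra of wedge products -/

section WedgeAlgebra

variable {V W ι κ μ ι' κ' : Type*} [AddCommGroup V] [Module ℝ V] [AddCommGroup W] [Module ℝ W]
  [Fintype ι] [Fintype κ] [Fintype μ] [Fintype ι'] [Fintype κ']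
  [DecidableEq ι] [DecidableEq κ] [DecidableEq μ] [DecidableEq ι'] [DecidableEq κ']

/-- The wedge product of scalar alternating maps, with arguments indexed by a disjoint union. -/
noncomputable def wedgeSum (a : V [⋀^ι]→ₗ[ℝ] ℝ) (b : V [⋀^κ]→ₗ[ℝ] ℝ) : V [⋀^ι ⊕ κ]→ₗ[ℝ] ℝ :=
  (LinearMap.mul' ℝ ℝ).compAlternatingMap (a.domCoprod b)

/-- The product of scalar multilinear maps, with arguments indexed by a disjoint union. -/
noncomputable def mulSum (a : MultilinearMap ℝ (fun _ : ι => V) ℝ)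
    (b : MultilinearMap ℝ (fun _ : κ => V) ℝ) : MultilinearMap ℝ (fun _ : ι ⊕ κ => V) ℝ :=
  (LinearMap.mul' ℝ ℝ).compMultilinearMap (a.domCoprod b)

omit [Fintype ι] [Fintype κ] [DecidableEq ι] [DecidableEq κ] in
theorem mulSum_apply (a : MultilinearMap ℝ (fun _ : ι => V) ℝ)
    (b : MultilinearMap ℝ (fun _ : κ => V) ℝ) (v : ι ⊕ κ → V) :
    mulSum a b v = a (fun i => v (Sum.inl i)) * b (fun i => v (Sum.inr i)) := by
  simp [mulSum]

/-- The contribution of one shuffle, in terms of any permutation that represents it. -/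
theorem summand_apply (a : V [⋀^ι]→ₗ[ℝ] ℝ) (b : V [⋀^κ]→ₗ[ℝ] ℝ) (σ : Equiv.Perm (ι ⊕ κ))
    (v : ι ⊕ κ → V) :
    LinearMap.mul' ℝ ℝ (AlternatingMap.domCoprod.summand a b (Quotient.mk'' σ) v) =
      ((Equiv.Perm.sign σ : ℤ) : ℝ) *
        (a (fun i => v (σ (Sum.inl i))) * b (fun i => v (σ (Sum.inr i)))) := by
  rw [AlternatingMap.domCoprod.summand_mk'']
  rcases Int.units_eq_one_or (Equiv.Perm.sign σ) with hs | hs <;> rw [hs]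
  · rw [one_smul]
    simp [MultilinearMap.domDomCongr_apply]
  · rw [Units.neg_smul, one_smul]
    simp [MultilinearMap.domDomCongr_apply]

theorem wedgeSum_apply (a : V [⋀^ι]→ₗ[ℝ] ℝ) (b : V [⋀^κ]→ₗ[ℝ] ℝ) (v : ι ⊕ κ → V) :
    wedgeSum a b v = ∑ σ : Equiv.Perm.ModSumCongr ι κ,
      LinearMap.mul' ℝ ℝ (AlternatingMap.domCoprod.summand a b σ v) := by
  simp only [wedgeSum, LinearMap.compAlternatingMap_apply, AlternatingMap.domCoprod_apply,
    sum_apply, map_sum]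

theorem alternatization_mulSum (a : MultilinearMap ℝ (fun _ : ι => V) ℝ)
    (b : MultilinearMap ℝ (fun _ : κ => V) ℝ) :
    MultilinearMap.alternatization (mulSum a b) =
      wedgeSum (MultilinearMap.alternatization a) (MultilinearMap.alternatization b) := by
  rw [wedgeSum, ← MultilinearMap.domCoprod_alternization, mulSum,
    LinearMap.compMultilinearMap_alternatization]

theorem wedgeSum_smul_left (c : ℝ) (a : V [⋀^ι]→ₗ[ℝ] ℝ) (b : V [⋀^κ]→ₗ[ℝ] ℝ) :
    wedgeSum (c • a) b = c • wedgeSum a b := by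
  simp only [wedgeSum, ← AlternatingMap.domCoprod'_apply, ← TensorProduct.smul_tmul', map_smul]
  ext; simp

theorem wedgeSum_smul_right (c : ℝ) (a : V [⋀^ι]→ₗ[ℝ] ℝ) (b : V [⋀^κ]→ₗ[ℝ] ℝ) :
    wedgeSum a (c • b) = c • wedgeSum a b := by
  simp only [wedgeSum, ← AlternatingMap.domCoprod'_apply, TensorProduct.tmul_smul, map_smul]
  ext; simp

theorem wedgeSum_add_right (a : V [⋀^ι]→ₗ[ℝ] ℝ) (b c : V [⋀^κ]→ₗ[ℝ] ℝ) :
    wedgeSum a (b + c) = wedgeSum a b + wedgeSum a c := by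
  simp only [wedgeSum, ← AlternatingMap.domCoprod'_apply, TensorProduct.tmul_add, map_add]
  ext; simp

theorem alternatization_coe_eq_smul (a : V [⋀^ι]→ₗ[ℝ] ℝ) :
    MultilinearMap.alternatization (a : MultilinearMap ℝ (fun _ : ι => V) ℝ) =
      ((Fintype.card ι).factorial : ℝ) • a := by
  rw [AlternatingMap.coe_alternatization, Nat.cast_smul_eq_nsmul]

/-- Alternatization commutes with a change of the index type. -/
theorem alternatization_reindex (e : ι ≃ ι') (m : MultilinearMap ℝ (fun _ : ι => V) ℝ)
    (m' : MultilinearMap ℝ (fun _ : ι' => V) ℝ) (h : ∀ v : ι' → V, m' v = m (v ∘ e))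
    (v : ι' → V) :
    MultilinearMap.alternatization m' v = MultilinearMap.alternatization m (v ∘ e) := by
  rw [MultilinearMap.alternatization_apply, MultilinearMap.alternatization_apply]
  refine Fintype.sum_equiv e.symm.permCongr _ _ fun σ => ?_
  rw [Equiv.Perm.sign_permCongr]
  congr 1
  simp only [MultilinearMap.domDomCongr_apply, h]
  congr 1
  funext i
  simp

/-- Alternatizing `a ⊗ b` yields the wedge product up to factorials, which do not change when the
index types are replaced by equivalent ones. -/
theorem wedgeSum_domDomCongr (e : ι ≃ ι') (e' : κ ≃ κ') (a : V [⋀^ι]→ₗ[ℝ] ℝ)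
    (b : V [⋀^κ]→ₗ[ℝ] ℝ) (v : ι' ⊕ κ' → V) :
    wedgeSum (a.domDomCongr e) (b.domDomCongr e') v =
      wedgeSum a b (v ∘ Equiv.sumCongr e e') := by
  have h := alternatization_reindex (Equiv.sumCongr e e') (mulSum (a : MultilinearMap ℝ _ ℝ) b)
    (mulSum (a.domDomCongr e : MultilinearMap ℝ _ ℝ) (b.domDomCongr e'))
    (fun v => by simp [mulSum_apply, Function.comp_def]) v
  simp only [alternatization_mulSum, alternatization_coe_eq_smul, wedgeSum_smul_left,
    wedgeSum_smul_right, AlternatingMap.smul_apply, ← Fintype.card_congr e,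
    ← Fintype.card_congr e'] at h
  simpa [Nat.factorial_ne_zero] using h

/-- Up to the same factorials, both sides are the alternatization of the product `a ⊗ b ⊗ c`. -/
theorem wedgeSum_assoc (a : V [⋀^ι]→ₗ[ℝ] ℝ) (b : V [⋀^κ]→ₗ[ℝ] ℝ) (c : V [⋀^μ]→ₗ[ℝ] ℝ)
    (v : ι ⊕ (κ ⊕ μ) → V) :
    wedgeSum a (wedgeSum b c) v =
      wedgeSum (wedgeSum a b) c (v ∘ Equiv.sumAssoc ι κ μ) := by
  have h := alternatization_reindex (Equiv.sumAssoc ι κ μ)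
    (mulSum (mulSum (a : MultilinearMap ℝ _ ℝ) b) c)
    (mulSum (a : MultilinearMap ℝ _ ℝ) (mulSum (b : MultilinearMap ℝ _ ℝ) c))
    (fun v => by simp [mulSum_apply, mul_assoc]) v
  simp only [alternatization_mulSum, alternatization_coe_eq_smul, wedgeSum_smul_left,
    wedgeSum_smul_right, AlternatingMap.smul_apply] at h
  simpa [Nat.factorial_ne_zero] using h

theorem wedgeSum_compLinearMap (a : W [⋀^ι]→ₗ[ℝ] ℝ) (b : W [⋀^κ]→ₗ[ℝ] ℝ) (f : V →ₗ[ℝ] W)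
    (v : ι ⊕ κ → V) :
    wedgeSum (a.compLinearMap f) (b.compLinearMap f) v = wedgeSum a b (f ∘ v) := by
  simp only [wedgeSum_apply]
  refine Finset.sum_congr rfl fun σ _ => ?_
  induction σ using Quotient.inductionOn' with
  | h σ =>
    rw [summand_apply, summand_apply]
    rfl

/-- The permutations of `ι ⊕ κ`, as permutations of `ι ⊕ (κ ⊕ μ)` that fix `μ`. -/
def extendPerm (ι κ μ : Type*) : Equiv.Perm (ι ⊕ κ) →* Equiv.Perm (ι ⊕ (κ ⊕ μ)) where
  toFun τ := (Equiv.sumAssoc ι κ μ).permCongr (Equiv.sumCongr τ 1)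
  map_one' := by ext (i | i | i) <;> simp
  map_mul' σ τ := by
    ext (i | i | i) <;> simp

omit [Fintype ι] [Fintype κ] [Fintype μ] [DecidableEq ι] [DecidableEq κ] [DecidableEq μ] in
@[simp] theorem extendPerm_inl (τ : Equiv.Perm (ι ⊕ κ)) (i : ι) :
    extendPerm ι κ μ τ (Sum.inl i) = Sum.map id Sum.inl (τ (Sum.inl i)) := by
  cases h : τ (Sum.inl i) <;> simp [extendPerm, h]

omit [Fintype ι] [Fintype κ] [Fintype μ] [DecidableEq ι] [DecidableEq κ] [DecidableEq μ] in
@[simp] theorem extendPerm_inr_inl (τ : Equiv.Perm (ι ⊕ κ)) (i : κ) :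
    extendPerm ι κ μ τ (Sum.inr (Sum.inl i)) = Sum.map id Sum.inl (τ (Sum.inr i)) := by
  cases h : τ (Sum.inr i) <;> simp [extendPerm, h]

omit [Fintype ι] [Fintype κ] [Fintype μ] [DecidableEq ι] [DecidableEq κ] [DecidableEq μ] in
@[simp] theorem extendPerm_inr_inr (τ : Equiv.Perm (ι ⊕ κ)) (i : μ) :
    extendPerm ι κ μ τ (Sum.inr (Sum.inr i)) = Sum.inr (Sum.inr i) := by
  simp [extendPerm]

theorem sign_extendPerm (τ : Equiv.Perm (ι ⊕ κ)) :
    Equiv.Perm.sign (extendPerm ι κ μ τ) = Equiv.Perm.sign τ := by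
  simp [extendPerm]

omit [Fintype μ] [DecidableEq ι] [DecidableEq κ] [DecidableEq μ] in
/-- The extension respects the equivalence of permutations that defines shuffles. -/
theorem extendPerm_mem_range_iff (τ : Equiv.Perm (ι ⊕ κ)) :
    extendPerm ι κ μ τ ∈ (Equiv.Perm.sumCongrHom ι (κ ⊕ μ)).range ↔
      τ ∈ (Equiv.Perm.sumCongrHom ι κ).range := by
  constructor
  · rintro ⟨⟨s, t⟩, h⟩
    refine Equiv.Perm.mem_sumCongrHom_range_of_perm_mapsTo_inl ?_
    rintro _ ⟨i, rfl⟩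
    have := congrArg (fun ρ => ρ (Sum.inl i)) h
    cases hτ : τ (Sum.inl i) with
    | inl j => exact ⟨j, rfl⟩
    | inr j => simp [hτ] at this
  · rintro ⟨⟨s, t⟩, rfl⟩
    refine ⟨(s, Equiv.sumCongr t 1), ?_⟩
    ext (i | i | i) <;> simp

/-- The map from the shuffles of `ι ⊕ κ` to those of `ι ⊕ (κ ⊕ μ)` that extends a shuffle by the
identity of `μ`. Shuffles are cosets of the permutations that preserve the two summands. -/
def extendShuffle (ι κ μ : Type*) [Fintype ι] [Fintype κ] [Fintype μ] [DecidableEq ι]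
    [DecidableEq κ] [DecidableEq μ] :
    Equiv.Perm.ModSumCongr ι κ → Equiv.Perm.ModSumCongr ι (κ ⊕ μ) :=
  Quotient.map' (extendPerm ι κ μ) fun σ τ h => by
    rw [QuotientGroup.leftRel_apply] at h ⊢
    rw [← map_inv, ← map_mul]
    exact (extendPerm_mem_range_iff _).2 h

theorem extendShuffle_injective : Function.Injective (extendShuffle ι κ μ) := by
  intro σ τ
  induction σ using Quotient.inductionOn' with
  | h σ =>
  induction τ using Quotient.inductionOn' with
  | h τ =>
    intro h
    have h' := Quotient.exact' h
    rw [QuotientGroup.leftRel_apply, ← map_inv, ← map_mul, extendPerm_mem_range_iff] at h'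
    exact Quotient.sound' (QuotientGroup.leftRel_apply.2 h')

/-- A shuffle of `ι ⊕ (κ ⊕ μ)` that sends no element of `ι` to `μ` comes from a shuffle
of `ι ⊕ κ`. -/
theorem mem_range_extendShuffle (σ : Equiv.Perm (ι ⊕ (κ ⊕ μ)))
    (hσ : ∀ i n, σ (Sum.inl i) ≠ Sum.inr (Sum.inr n)) :
    (Quotient.mk'' σ : Equiv.Perm.ModSumCongr ι (κ ⊕ μ)) ∈ Set.range (extendShuffle ι κ μ) := by
  have h1 : ∀ n : μ, ∃ j : κ ⊕ μ, σ (Sum.inr j) = Sum.inr (Sum.inr n) := by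
    intro n
    rcases h : σ.symm (Sum.inr (Sum.inr n)) with i | j
    · exact absurd ((Equiv.symm_apply_eq σ).1 h).symm (hσ i n)
    · exact ⟨j, ((Equiv.symm_apply_eq σ).1 h).symm⟩
  choose g hg using h1
  have hginj : Function.Injective g := fun m n h => by
    have := (hg m).symm.trans ((congrArg (fun j => σ (Sum.inr j)) h).trans (hg n))
    simpa using this
  obtain ⟨ρ, hρ⟩ := Equiv.Perm.exists_extending_pair (Sum.inr : μ → κ ⊕ μ) g
    Sum.inr_injective hginj
  -- Modulo permutations of `κ ⊕ μ`, the permutation fixes `μ` pointwise.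
  set σ' : Equiv.Perm (ι ⊕ (κ ⊕ μ)) := σ * Equiv.sumCongr 1 ρ with hσ'
  have hfix : ∀ n, σ' (Sum.inr (Sum.inr n)) = Sum.inr (Sum.inr n) := fun n => by
    have := hρ n
    simp [hσ', this, hg]
  -- Hence it permutes the rest, and it is the extension of a permutation of `ι ⊕ κ`.
  have hmaps : Set.MapsTo ((Equiv.sumAssoc ι κ μ).symm.permCongr σ') (Set.range Sum.inr)
      (Set.range Sum.inr) := by
    rintro _ ⟨n, rfl⟩
    exact ⟨n, by simp [hfix]⟩
  obtain ⟨⟨τ, t⟩, hτ⟩ := Equiv.Perm.mem_sumCongrHom_range_of_perm_mapsTo_inl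
    ((Equiv.Perm.perm_mapsTo_inl_iff_mapsTo_inr _).2 hmaps)
  have ht : t = 1 := by
    ext n
    have := congrArg (fun ρ => ρ (Sum.inr n)) hτ
    simpa [hfix] using this
  subst ht
  refine ⟨Quotient.mk'' τ, Quotient.sound' (QuotientGroup.leftRel_apply.2 ?_)⟩
  have : extendPerm ι κ μ τ = σ' := by
    apply (Equiv.sumAssoc ι κ μ).symm.permCongr.injective
    rw [← hτ]
    ext i
    simp [extendPerm]
  rw [this]
  refine Subgroup.inv_mem_iff _ |>.1 ⟨(1, ρ), ?_⟩
  simp [hσ']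

/-- Evaluating the last arguments of a wedge product at vectors that the first factor kills amounts
to evaluating the last arguments of the second factor: in the sum over shuffles, only those
contribute which hand these vectors to the second factor, and these are the shuffles of the
remaining arguments. -/
theorem wedgeSum_fill (a : W [⋀^ι]→ₗ[ℝ] ℝ) (b : W [⋀^κ ⊕ μ]→ₗ[ℝ] ℝ) (ℓ : V → W) (f : μ → W)
    (a' : V [⋀^ι]→ₗ[ℝ] ℝ) (b' : V [⋀^κ]→ₗ[ℝ] ℝ)
    (ha : ∀ m i n, m i = f n → a m = 0) (ha' : ∀ m, a' m = a (ℓ ∘ m))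
    (hb' : ∀ m, b' m = b (Sum.elim (ℓ ∘ m) f)) (v : ι ⊕ κ → V) (w : ι ⊕ (κ ⊕ μ) → W)
    (hw : ∀ i, w (Sum.map id Sum.inl i) = ℓ (v i)) (hwf : ∀ n, w (Sum.inr (Sum.inr n)) = f n) :
    wedgeSum a b w = wedgeSum a' b' v := by
  rw [wedgeSum_apply, wedgeSum_apply]
  symm
  refine Finset.sum_of_injOn (extendShuffle ι κ μ) extendShuffle_injective.injOn
    (fun _ _ => Finset.mem_coe.2 (Finset.mem_univ _)) ?_ ?_
  · intro σ _ hσ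
    induction σ using Quotient.inductionOn' with
    | h σ =>
      rw [summand_apply]
      have : ∃ i n, σ (Sum.inl i) = Sum.inr (Sum.inr n) := by
        by_contra! h
        obtain ⟨τ, hτ⟩ := mem_range_extendShuffle σ h
        exact hσ ⟨τ, Finset.mem_coe.2 (Finset.mem_univ _), hτ⟩
      obtain ⟨i, n, hin⟩ := this
      rw [ha _ i n (by simp [hin, hwf]), zero_mul, mul_zero]
  · intro σ _
    induction σ using Quotient.inductionOn' with
    | h σ =>
      change _ = LinearMap.mul' ℝ ℝ (AlternatingMap.domCoprod.summand a b
        (Quotient.mk'' (extendPerm ι κ μ σ)) w)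
      rw [summand_apply, summand_apply, sign_extendPerm, ha', hb']
      congr 3
      · funext i
        simp [hw]
      · funext i
        rcases i with i | i <;> simp [hw, hwf]

end WedgeAlgebra

/-! ### Wedge products of continuous alternating maps -/

section WedgeForms

variable {V W : Type*} [NormedAddCommGroup V] [NormedSpace ℝ V]
  [NormedAddCommGroup W] [NormedSpace ℝ W]

theorem wedgeAt_apply {p q r : ℕ} (h : p + q = r) (a : V [⋀^Fin p]→L[ℝ] ℝ)
    (b : V [⋀^Fin q]→L[ℝ] ℝ) (v : Fin r → V) :
    wedgeAt h a b v = wedgeSum a.toAlternatingMap b.toAlternatingMap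
      (v ∘ finSumFinEquiv.trans (finCongr h)) := rfl

theorem wedgeAt_toAlternatingMap {p q r : ℕ} (h : p + q = r) (a : V [⋀^Fin p]→L[ℝ] ℝ)
    (b : V [⋀^Fin q]→L[ℝ] ℝ) :
    (wedgeAt h a b).toAlternatingMap =
      (wedgeSum a.toAlternatingMap b.toAlternatingMap).domDomCongr
        (finSumFinEquiv.trans (finCongr h)) := rfl

theorem wedgeAt_smul_right {p q r : ℕ} (h : p + q = r) (c : ℝ) (a : V [⋀^Fin p]→L[ℝ] ℝ)
    (b : V [⋀^Fin q]→L[ℝ] ℝ) : wedgeAt h a (c • b) = c • wedgeAt h a b := by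
  ext v
  rw [ContinuousAlternatingMap.smul_apply, wedgeAt_apply, wedgeAt_apply]
  exact DFunLike.congr_fun (wedgeSum_smul_right c a.toAlternatingMap b.toAlternatingMap) _

theorem wedgeAt_add_right {p q r : ℕ} (h : p + q = r) (a : V [⋀^Fin p]→L[ℝ] ℝ)
    (b c : V [⋀^Fin q]→L[ℝ] ℝ) : wedgeAt h a (b + c) = wedgeAt h a b + wedgeAt h a c := by
  ext v
  rw [ContinuousAlternatingMap.add_apply, wedgeAt_apply, wedgeAt_apply, wedgeAt_apply]
  exact DFunLike.congr_fun
    (wedgeSum_add_right a.toAlternatingMap b.toAlternatingMap c.toAlternatingMap) _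

theorem wedgeAt_compContinuousLinearMap {p q r : ℕ} (h : p + q = r) (a : W [⋀^Fin p]→L[ℝ] ℝ)
    (b : W [⋀^Fin q]→L[ℝ] ℝ) (f : V →L[ℝ] W) :
    (wedgeAt h a b).compContinuousLinearMap f =
      wedgeAt h (a.compContinuousLinearMap f) (b.compContinuousLinearMap f) := by
  ext v
  exact (wedgeSum_compLinearMap a.toAlternatingMap b.toAlternatingMap (f : V →ₗ[ℝ] W) _).symm

theorem wedgeAt_assoc {p q r s t n : ℕ} (h₁ : p + q = s) (h₂ : s + r = n) (h₃ : q + r = t)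
    (h₄ : p + t = n) (a : V [⋀^Fin p]→L[ℝ] ℝ) (b : V [⋀^Fin q]→L[ℝ] ℝ)
    (c : V [⋀^Fin r]→L[ℝ] ℝ) :
    wedgeAt h₂ (wedgeAt h₁ a b) c = wedgeAt h₄ a (wedgeAt h₃ b c) := by
  subst h₁ h₃ h₄
  ext v
  rw [wedgeAt_apply, wedgeAt_apply, wedgeAt_toAlternatingMap, wedgeAt_toAlternatingMap]
  have e₁ := wedgeSum_domDomCongr (finSumFinEquiv.trans (finCongr (rfl : p + q = p + q)))
    (Equiv.refl (Fin r)) (wedgeSum a.toAlternatingMap b.toAlternatingMap) c.toAlternatingMap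
  have e₂ := wedgeSum_domDomCongr (Equiv.refl (Fin p))
    (finSumFinEquiv.trans (finCongr (rfl : q + r = q + r)))
    a.toAlternatingMap (wedgeSum b.toAlternatingMap c.toAlternatingMap)
  rw [AlternatingMap.domDomCongr_refl] at e₁ e₂
  rw [e₁, e₂, wedgeSum_assoc]
  congr 1
  funext i
  rcases i with (i | i) | i
  all_goals
    simp only [Function.comp_apply]
    congr 1
  ext
  simp [add_assoc]

/-- The wedge product form of `wedgeSum_fill`: if `a` kills the vectors `f`, then evaluating
`a ∧ b` at lifts by `ℓ` followed by `f` amounts to wedging the pullback of `a` with the partial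
evaluation of `b` at `f`. -/
theorem wedgeAt_append {p d m t s n : ℕ} (h₁ : d + m = t) (h₂ : p + t = n) (h₃ : p + d = s)
    (h₄ : n = s + m) (a : W [⋀^Fin p]→L[ℝ] ℝ) (b : W [⋀^Fin t]→L[ℝ] ℝ) (ℓ : V →L[ℝ] W)
    (f : Fin m → W) (ha : ∀ w i j, w i = f j → a w = 0) (v : Fin s → V) :
    wedgeAt h₂ a b (Fin.append (fun i => ℓ (v i)) f ∘ Fin.cast h₄) =
      wedgeAt h₃ (a.compContinuousLinearMap ℓ) (fillLast h₁ b ℓ f) v := by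
  subst h₁ h₂ h₃
  rw [wedgeAt_apply, wedgeAt_apply]
  have e := wedgeSum_domDomCongr (Equiv.refl (Fin p)) (finSumFinEquiv (m := d) (n := m))
    a.toAlternatingMap (b.toAlternatingMap.domDomCongr finSumFinEquiv.symm)
  rw [AlternatingMap.domDomCongr_refl, ← AlternatingMap.domDomCongr_trans, Equiv.symm_trans_self,
    AlternatingMap.domDomCongr_refl] at e
  rw [e]
  refine wedgeSum_fill _ _ ℓ f _ _ ha (fun _ => rfl) ?_ _ _ ?_ ?_
  · intro w
    change b _ = b _
    congr 1
    funext i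
    refine Fin.addCases (fun i => ?_) (fun i => ?_) i <;> simp
  · intro i
    have : ∀ j : Fin (p + d), Fin.append (fun i => ℓ (v i)) f (Fin.castAdd m j) = ℓ (v j) :=
      fun j => by simp
    rcases i with i | i
    all_goals
      simp only [Function.comp_apply]
      rw [← this]
      congr 1
  · intro j
    have := Fin.append_right (fun i => ℓ (v i)) f j
    rw [← this]
    simp only [Function.comp_apply]
    congr 1
    ext
    simp
    omega

variable {T : Type*} [TopologicalSpace T]

/-- An alternating map depending continuously on a parameter may be evaluated at vectors depending
continuously on that parameter. -/
theorem _root_.ContinuousOn.alternatingMap_apply {p : ℕ} {S : Set T}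
    {A : T → V [⋀^Fin p]→L[ℝ] ℝ} {v : T → Fin p → V} (hA : ContinuousOn A S)
    (hv : ContinuousOn v S) : ContinuousOn (fun t => A t (v t)) S := by
  have h : Continuous fun q : (V [⋀^Fin p]→L[ℝ] ℝ) × (Fin p → V) => q.1 q.2 :=
    ContinuousEval.continuous_eval
  exact h.comp_continuousOn (hA.prodMk hv)

theorem continuousOn_wedgeAt_apply {p q r : ℕ} (h : p + q = r) {S : Set T}
    {A : T → V [⋀^Fin p]→L[ℝ] ℝ} {B : T → V [⋀^Fin q]→L[ℝ] ℝ} {v : T → Fin r → V}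
    (hA : ∀ w : T → Fin p → V, ContinuousOn w S → ContinuousOn (fun t => A t (w t)) S)
    (hB : ∀ w : T → Fin q → V, ContinuousOn w S → ContinuousOn (fun t => B t (w t)) S)
    (hv : ContinuousOn v S) :
    ContinuousOn (fun t => wedgeAt h (A t) (B t) (v t)) S := by
  simp only [wedgeAt_apply, wedgeSum_apply]
  refine continuousOn_finsetSum _ fun σ _ => ?_
  induction σ using Quotient.inductionOn' with
  | h σ =>
    simp only [summand_apply]
    have hv' := continuousOn_pi.1 hv
    exact continuousOn_const.mul
      ((hA _ (continuousOn_pi.2 fun i => hv' _)).mul (hB _ (continuousOn_pi.2 fun i => hv' _)))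

/-- The values of an alternating map at the tuples of basis vectors. -/
noncomputable def basisValues (V : Type*) [NormedAddCommGroup V] [NormedSpace ℝ V]
    [FiniteDimensional ℝ V] (p : ℕ) :
    (V [⋀^Fin p]→L[ℝ] ℝ) →ₗ[ℝ] ((Fin p → Fin (Module.finrank ℝ V)) → ℝ) where
  toFun a s := a fun i => Module.finBasis ℝ V (s i)
  map_add' _ _ := rfl
  map_smul' _ _ := rfl

theorem basisValues_injective [FiniteDimensional ℝ V] (p : ℕ) :
    Function.Injective (basisValues V p) := fun x y h => by
  apply ContinuousAlternatingMap.toAlternatingMap_injective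
  exact Module.Basis.ext_alternating (Module.finBasis ℝ V) fun s _ => by
    exact congrFun h s

instance finiteDimensional_continuousAlternatingMap [FiniteDimensional ℝ V] {p : ℕ} :
    FiniteDimensional ℝ (V [⋀^Fin p]→L[ℝ] ℝ) :=
  FiniteDimensional.of_injective (basisValues V p) (basisValues_injective p)

/-- On a finite-dimensional space, an alternating map depends continuously on a parameter as soon as
all of its values do. -/
theorem continuousOn_alternatingMap_of_apply [FiniteDimensional ℝ V] {p : ℕ} {S : Set T}
    {A : T → V [⋀^Fin p]→L[ℝ] ℝ} (hA : ∀ v, ContinuousOn (fun t => A t v) S) :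
    ContinuousOn A S := by
  have := LinearMap.isClosedEmbedding_of_injective (f := basisValues V p)
    (LinearMap.ker_eq_bot.2 (basisValues_injective p))
  rw [this.isInducing.continuousOn_iff]
  exact continuousOn_pi.2 fun s => hA _

/-- Evaluation of `a ∧ b` at fixed vectors, as a continuous linear functional of `b`. -/
noncomputable def wedgeAtEval [FiniteDimensional ℝ V] {p q r : ℕ} (h : p + q = r)
    (a : V [⋀^Fin p]→L[ℝ] ℝ) (v : Fin r → V) : (V [⋀^Fin q]→L[ℝ] ℝ) →L[ℝ] ℝ :=
  LinearMap.toContinuousLinearMap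
    { toFun := fun b => wedgeAt h a b v
      map_add' := fun b c => by rw [wedgeAt_add_right]; rfl
      map_smul' := fun c b => by rw [wedgeAt_smul_right]; rfl }

@[simp] theorem wedgeAtEval_apply [FiniteDimensional ℝ V] {p q r : ℕ} (h : p + q = r)
    (a : V [⋀^Fin p]→L[ℝ] ℝ) (v : Fin r → V) (b : V [⋀^Fin q]→L[ℝ] ℝ) :
    wedgeAtEval h a v b = wedgeAt h a b v := rfl

end WedgeForms

/-! ### Forms in the coordinates of the compactified configuration space -/

section BlowupForms

variable {k : ℕ}

/-- The differential at `q = (x, r, u)` of the map `(x, r, u) ↦ y = x + r u`. -/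
noncomputable def dTarget (q : E k × ℝ × E k) : E k × ℝ × E k →L[ℝ] E k :=
  ContinuousLinearMap.fst ℝ (E k) (ℝ × E k) +
    (q.2.1 • (ContinuousLinearMap.snd ℝ ℝ (E k)).comp
        (ContinuousLinearMap.snd ℝ (E k) (ℝ × E k)) +
      ((ContinuousLinearMap.fst ℝ ℝ (E k)).comp
        (ContinuousLinearMap.snd ℝ (E k) (ℝ × E k))).smulRight q.2.2)

theorem dTarget_apply (q v : E k × ℝ × E k) :
    dTarget q v = v.1 + (q.2.1 • v.2.2 + v.2.1 • q.2.2) := by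
  simp [dTarget]

/-- The projection `(x, r, u) ↦ u`. -/
noncomputable def dirProj (k : ℕ) : E k × ℝ × E k →L[ℝ] E k :=
  (ContinuousLinearMap.snd ℝ ℝ (E k)).comp (ContinuousLinearMap.snd ℝ (E k) (ℝ × E k))

theorem hasFDerivAt_blowup (q : E k × ℝ × E k) :
    HasFDerivAt blowup ((ContinuousLinearMap.fst ℝ (E k) (ℝ × E k)).prod
      ((dTarget q).prod ((-dirProj k).prod (dirProj k)))) q := by
  have h1 : HasFDerivAt (fun q : E k × ℝ × E k => q.1) _ q :=
    (ContinuousLinearMap.fst ℝ (E k) (ℝ × E k)).hasFDerivAt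
  have h2 : HasFDerivAt (fun q : E k × ℝ × E k => q.2.1) _ q :=
    ((ContinuousLinearMap.fst ℝ ℝ (E k)).comp
      (ContinuousLinearMap.snd ℝ (E k) (ℝ × E k))).hasFDerivAt
  have h3 : HasFDerivAt (fun q : E k × ℝ × E k => q.2.2) _ q := (dirProj k).hasFDerivAt
  exact h1.prodMk ((h1.add (h2.smul h3)).prodMk (h3.neg.prodMk h3))

theorem continuous_blowup : Continuous (blowup : E k × ℝ × E k → Amb k) :=
  continuous_iff_continuousAt.2 fun q => (hasFDerivAt_blowup q).continuousAt

theorem pullback_wedge {V W : Type*} [NormedAddCommGroup V] [NormedSpace ℝ V]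
    [NormedAddCommGroup W] [NormedSpace ℝ W] {p q r : ℕ} (h : p + q = r) (f : V → W)
    (θ : DForm W p) (η : DForm W q) (x : V) :
    pullback f (wedge h θ η) x = wedgeAt h (pullback f θ x) (pullback f η x) :=
  wedgeAt_compContinuousLinearMap h _ _ _

theorem pullback_blowup_projX {p : ℕ} (α : DForm (E k) p) (q : E k × ℝ × E k) :
    pullback blowup (pullback projX α) q =
      (α q.1).compContinuousLinearMap (ContinuousLinearMap.fst ℝ (E k) (ℝ × E k)) := by
  have h : HasFDerivAt (projX : Amb k → E k) _ (blowup q) :=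
    (ContinuousLinearMap.fst ℝ (E k) (E k × E k × E k)).hasFDerivAt
  ext v
  simp only [pullback, h.fderiv, (hasFDerivAt_blowup q).fderiv]
  rfl

theorem pullback_blowup_projY {p : ℕ} (α : DForm (E k) p) (q : E k × ℝ × E k) :
    pullback blowup (pullback projY α) q =
      (α (q.1 + q.2.1 • q.2.2)).compContinuousLinearMap (dTarget q) := by
  have h : HasFDerivAt (projY : Amb k → E k) _ (blowup q) :=
    ((ContinuousLinearMap.fst ℝ (E k) (E k × E k)).comp
      (ContinuousLinearMap.snd ℝ (E k) (E k × E k × E k))).hasFDerivAt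
  ext v
  simp only [pullback, h.fderiv, (hasFDerivAt_blowup q).fderiv]
  rfl

theorem pullback_blowup_gauss {p : ℕ} (α : DForm (E k) p) (q : E k × ℝ × E k) :
    pullback blowup (pullback gauss α) q = (α q.2.2).compContinuousLinearMap (dirProj k) := by
  have h : HasFDerivAt (gauss : Amb k → E k) _ (blowup q) :=
    ((ContinuousLinearMap.snd ℝ (E k) (E k)).comp
      ((ContinuousLinearMap.snd ℝ (E k) (E k × E k)).comp
      (ContinuousLinearMap.snd ℝ (E k) (E k × E k × E k)))).hasFDerivAt
  ext v
  simp only [pullback, h.fderiv, (hasFDerivAt_blowup q).fderiv]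
  rfl

theorem pullback_blowup_biotSavartForm (α : DForm (E k) (k + 1)) (q : E k × ℝ × E k) :
    pullback blowup (biotSavartForm α) q = wedgeAt (by omega)
      ((α (q.1 + q.2.1 • q.2.2)).compContinuousLinearMap (dTarget q))
      ((sphereForm k q.2.2).compContinuousLinearMap (dirProj k)) := by
  rw [biotSavartForm, pullback_wedge, pullback_blowup_projY, pullback_blowup_gauss]

/-- By associativity, `α_x ∧ α_y ∧ g^*dVol` is the wedge product of `α_x` with the Biot-Savart
form, up to the normalization of the volume form. -/
theorem pullback_blowup_helicityForm (α : DForm (E k) (k + 1)) (q : E k × ℝ × E k) :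
    pullback blowup (helicityForm α) q = (sphereVol k)⁻¹ • wedgeAt (by omega)
      ((α q.1).compContinuousLinearMap (ContinuousLinearMap.fst ℝ (E k) (ℝ × E k)))
      (pullback blowup (biotSavartForm α) q) := by
  rw [helicityForm, pullback_wedge, pullback_wedge, pullback_blowup_projX, pullback_blowup_projY,
    pullback_blowup_gauss, pullback_blowup_biotSavartForm]
  have : (unitSphereForm k q.2.2).compContinuousLinearMap (dirProj k) =
      (sphereVol k)⁻¹ • (sphereForm k q.2.2).compContinuousLinearMap (dirProj k) := rfl
  rw [this, wedgeAt_smul_right]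
  congr 1
  exact wedgeAt_assoc _ _ _ _ _ _ _

/-- The helicity density at a point `(x, r, u)` of the configuration space is the wedge product
of `α` at `x` with the Biot-Savart integrand at `(r, u)`. -/
theorem configDensity_helicityForm (α : DForm (E k) (k + 1)) (c : E k × ℝ × S k) :
    configDensity (helicityForm α) c = (sphereVol k)⁻¹ * wedgeAt (by omega) (α c.1)
      (fiberDensity (d := k) (by omega) (biotSavartForm α) c.1 c.2) (stdFrame k) := by
  rw [configDensity, pullback_blowup_helicityForm, ContinuousAlternatingMap.smul_apply,
    smul_eq_mul, configFrame,
    wedgeAt_append (p := k + 1) (d := k) (s := 2 * k + 1) (by omega) (by omega) (by omega)]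
  · congr 2
  -- The base component of every vector of the fiber frame is zero.
  · intro w i j h
    refine (α c.1).map_coord_zero i ?_
    simp [h, fiberFrame]

end BlowupForms

/-! ### Compactness and integration over the configuration space -/

section ConfigurationSpace

variable {k : ℕ} {Ω : Set (E k)}

theorem mem_of_mem_configParam (hΩ : IsClosed Ω) {c : E k × ℝ × S k} (hc : c ∈ configParam Ω) :
    c.1 ∈ Ω ∧ c.1 + c.2.1 • (c.2.2 : E k) ∈ Ω := by
  have h : compactConfig Ω ⊆ {q : Amb k | q.1 ∈ Ω ∧ q.2.1 ∈ Ω} := by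
    refine closure_minimal ?_ ((hΩ.preimage continuous_fst).inter
      (hΩ.preimage (continuous_fst.comp continuous_snd)))
    rintro _ ⟨p, hp, rfl⟩
    exact ⟨hp.1, hp.2.1⟩
  exact h hc.2

theorem isClosed_configParam : IsClosed (configParam Ω) := by
  refine (isClosed_le continuous_const (continuous_fst.comp continuous_snd)).inter
    (isClosed_closure.preimage ?_)
  exact continuous_blowup.comp (by fun_prop)

/-- The coordinate `r` is the distance of two points of `Ω`, hence at most the diameter of `Ω`. -/
theorem isCompact_configParam (hΩ : IsCompact Ω) : IsCompact (configParam Ω) := by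
  refine (hΩ.prod (isCompact_Icc (a := 0) (b := Metric.diam Ω) |>.prod
    (isCompact_univ (X := S k)))).of_isClosed_subset isClosed_configParam ?_
  rintro ⟨x, r, u⟩ hc
  obtain ⟨hx, hy⟩ := mem_of_mem_configParam hΩ.isClosed hc
  have hr : 0 ≤ r := hc.1
  refine ⟨hx, ⟨hr, ?_⟩, mem_univ _⟩
  have := Metric.dist_le_diam_of_mem hΩ.isBounded hy hx
  simpa [dist_eq_norm, norm_smul, abs_of_nonneg hr] using this

theorem isCompact_fiberParam (hΩ : IsCompact Ω) (x : E k) : IsCompact (fiberParam Ω x) :=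
  ((isCompact_configParam hΩ).image continuous_snd).of_isClosed_subset
    (isClosed_configParam.preimage (by fun_prop)) fun c hc => ⟨(x, c), hc, rfl⟩

theorem fiberParam_eq_empty (hΩ : IsClosed Ω) {x : E k} (hx : x ∉ Ω) : fiberParam Ω x = ∅ :=
  eq_empty_of_forall_notMem fun _ hc => hx (mem_of_mem_configParam hΩ hc).1

theorem continuous_fiberFrame : Continuous (fiberFrame : S k → Fin (2 * k + 1) → _) := by
  unfold fiberFrame
  fun_prop

/-- In the coordinates `(x, r, u)`, the Biot-Savart integrand is continuous up to the face `r = 0`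
at which the two points collide. -/
theorem continuousOn_fiberDensity {α : DForm (E k) (k + 1)} (hΩ : IsClosed Ω)
    (hα : ContinuousOn α Ω) {h : k + (2 * k + 1) = 3 * k + 1} :
    ContinuousOn (fun c : E k × ℝ × S k => fiberDensity h (biotSavartForm α) c.1 c.2)
      (configParam Ω) := by
  refine continuousOn_alternatingMap_of_apply fun v => ?_
  change ContinuousOn (fun c : E k × ℝ × S k =>
    pullback blowup (biotSavartForm α) (c.1, c.2.1, (c.2.2 : E k))
      (Fin.append (baseLift k ∘ v) (fiberFrame c.2.2) ∘ Fin.cast h.symm)) _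
  simp only [pullback_blowup_biotSavartForm]
  refine continuousOn_wedgeAt_apply _ ?_ ?_ (Continuous.continuousOn ?_)
  · intro w hw
    refine ContinuousOn.alternatingMap_apply (v := fun c i => dTarget _ (w c i))
      (hα.comp (Continuous.continuousOn (by fun_prop))
        fun c hc => (mem_of_mem_configParam hΩ hc).2) ?_
    simp only [dTarget_apply]
    refine continuousOn_pi.2 fun i => ?_
    have hwi := continuousOn_pi.1 hw i
    have hr : Continuous fun c : E k × ℝ × S k => c.2.1 := by fun_prop
    have hu : Continuous fun c : E k × ℝ × S k => (c.2.2 : E k) := by fun_prop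
    exact hwi.fst.add ((hr.continuousOn.smul hwi.snd.snd).add
      (hwi.snd.fst.smul hu.continuousOn))
  · intro w hw
    refine ContinuousOn.alternatingMap_apply (A := fun c : E k × ℝ × S k =>
      sphereForm k (c.2.2 : E k)) (v := fun c i => dirProj _ (w c i))
      (Continuous.continuousOn ?_) ?_
    · exact ((detForm k).curryLeft.continuous).comp (by fun_prop)
    · refine continuousOn_pi.2 fun i => ?_
      exact (dirProj k).continuous.comp_continuousOn (continuousOn_pi.1 hw i)
  · refine continuous_pi fun i => ?_
    simp only [Function.comp_apply]
    generalize Fin.cast h.symm i = j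
    refine Fin.addCases (fun j => ?_) (fun j => ?_) j
    · simp only [Fin.append_left]
      fun_prop
    · simp only [Fin.append_right]
      exact (continuous_apply j).comp (continuous_fiberFrame.comp (by fun_prop))

instance : IsFiniteMeasure (sphereMeasure k) := by
  unfold sphereMeasure
  infer_instance

instance : SFinite (fiberMeasure k) := by
  unfold fiberMeasure
  infer_instance

instance : IsFiniteMeasureOnCompacts (fiberMeasure k) := by
  unfold fiberMeasure
  infer_instance

instance : IsFiniteMeasureOnCompacts (configMeasure k) := by
  unfold configMeasure
  infer_instance

theorem integrableOn_fiberDensity {α : DForm (E k) (k + 1)} (hΩ : IsCompact Ω)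
    (hα : ContinuousOn α Ω) {h : k + (2 * k + 1) = 3 * k + 1} (x : E k) :
    IntegrableOn (fiberDensity h (biotSavartForm α) x) (fiberParam Ω x) (fiberMeasure k) := by
  refine ContinuousOn.integrableOn_compact (isCompact_fiberParam hΩ x) ?_
  exact (continuousOn_fiberDensity hΩ.isClosed hα).comp
    (f := fun c : ℝ × S k => (x, c)) (by fun_prop) fun c hc => hc

theorem integrableOn_configDensity {α : DForm (E k) (k + 1)} (hΩ : IsCompact Ω)
    (hα : ContinuousOn α Ω) :
    IntegrableOn (configDensity (helicityForm α)) (configParam Ω) (configMeasure k) := by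
  refine ContinuousOn.integrableOn_compact (isCompact_configParam hΩ) ?_
  rw [funext (configDensity_helicityForm α)]
  refine continuousOn_const.mul (continuousOn_wedgeAt_apply _ (fun w hw => ?_) (fun w hw => ?_)
    continuousOn_const)
  · exact (hα.comp continuousOn_fst fun c hc =>
      (mem_of_mem_configParam hΩ.isClosed hc).1).alternatingMap_apply hw
  · exact (continuousOn_fiberDensity hΩ.isClosed hα).alternatingMap_apply hw

/-- The density of `α ∧ BS(α)` is the integral of the helicity density over the fiber. -/
theorem domainDensity_arnoldForm {α : DForm (E k) (k + 1)} (hΩ : IsCompact Ω)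
    (hα : ContinuousOn α Ω) (x : E k) :
    domainDensity (arnoldForm Ω α) x =
      ∫ c in fiberParam Ω x, configDensity (helicityForm α) (x, c) ∂(fiberMeasure k) := by
  simp only [configDensity_helicityForm]
  rw [integral_const_mul]
  change wedgeAt _ (α x) ((sphereVol k)⁻¹ • ∫ c in fiberParam Ω x,
    fiberDensity _ (biotSavartForm α) x c ∂(fiberMeasure k)) (stdFrame k) = _
  rw [wedgeAt_smul_right, ContinuousAlternatingMap.smul_apply, smul_eq_mul]
  congr 1
  exact ((wedgeAtEval _ (α x) (stdFrame k)).integral_comp_comm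
    (integrableOn_fiberDensity hΩ hα x)).symm

end ConfigurationSpace

end Helicity

open Helicity in
theorem mainTheorem6 (k : ℕ) (Ω : Set (Helicity.E k)) (hΩ : Helicity.IsCompactDomain Ω)
    (α : Helicity.DForm (Helicity.E k) (k + 1)) (hα : Helicity.IsClosedDirichletForm Ω α) :
    (∀ x ∈ Ω, IntegrableOn
      (Helicity.fiberDensity (d := k) (by omega) (Helicity.biotSavartForm α) x)
      (Helicity.fiberParam Ω x) (Helicity.fiberMeasure k)) ∧
    IntegrableOn (Helicity.domainDensity (Helicity.arnoldForm Ω α)) Ω ∧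
    IntegrableOn (Helicity.configDensity (Helicity.helicityForm α))
      (Helicity.configParam Ω) (Helicity.configMeasure k) ∧
    Helicity.domainIntegral Ω (Helicity.arnoldForm Ω α) =
      Helicity.configIntegral Ω (Helicity.helicityForm α) := by
  have hc := hα.smooth.continuousOn
  have hK := hΩ.isCompact
  have hmeas : MeasurableSet (configParam Ω) := isClosed_configParam.measurableSet
  have hint := integrableOn_configDensity hK hc
  let F : E k × ℝ × S k → ℝ := (configParam Ω).indicator (configDensity (helicityForm α))
  have hFint : Integrable F ((volume : Measure (E k)).prod (fiberMeasure k)) :=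
    (integrable_indicator_iff hmeas).2 hint
  -- Integrating over the fiber of the product reproduces the density of `α ∧ BS(α)`.
  have hfib : ∀ x, ∫ c, F (x, c) ∂(fiberMeasure k) = domainDensity (arnoldForm Ω α) x := by
    intro x
    rw [domainDensity_arnoldForm hK hc, ← integral_indicator
      (isCompact_fiberParam hK x).isClosed.measurableSet]
    rfl
  refine ⟨fun x _ => integrableOn_fiberDensity hK hc x, ?_, hint, ?_⟩
  · have := hFint.integral_prod_left
    simp only [hfib] at this
    exact this.integrableOn
  · have hzero : ∀ x ∉ Ω, domainDensity (arnoldForm Ω α) x = 0 := fun x hx => by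
      rw [domainDensity_arnoldForm hK hc, fiberParam_eq_empty hK.isClosed hx,
        setIntegral_empty]
    rw [domainIntegral, setIntegral_eq_integral_of_forall_compl_eq_zero hzero, configIntegral,
      ← integral_indicator hmeas, configMeasure, integral_prod _ hFint]
    simp only [hfib]
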